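/- Let $(R,\mathfrak m)$ be a Noetherian local ring of prime characteristic $p>0$. For an ideal $I\subseteq R$ and $e\ge 0$ let $I^{[p^e]}$ be the ideal generated by all $a^{p^e}$ with $a\in I$; $I$ is called Frobenius closed if every $x\in R$ such that $x^{p^e}\in I^{[p^e]}$ for some $e\geq 0$ already lies in $I$. A system of parameters of $R$ is a sequence of $\dim R$ elements of $R$ generating an ideal whose radical is $\mathfrak m$. Let $F_*R$ denote $R$ regarded as an $R$-module via the Frobenius endomorphism, and let $F\colon R\to F_*R$, $a\mapsto a^p$, which is $R$-linear. The Frobenius action on $H^j_{\mathfrak m}(R)$ is the induced map $H^j_{\mathfrak m}(F)\colon H^j_{\mathfrak m}(R)\to H^j_{\mathfrak m}(F_*R)$, whose target is canonically identified, as an abelian group, with $H^j_{\mathfrak m}(R)$. Suppose that every ideal of $R$ generated by a system of parameters is Frobenius closed. Then the Frobenius action on $H^j_{\mathfrak m}(R)$ is injective for $j=\dim R$ and for $j=\operatorname{depth} R$. -/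

import Mathlib

noncomputable section

namespace FrobeniusAction

open CategoryTheory IsLocalRing

universe u

section Ideals

variable {R : Type u} [CommRing R]

/-- `x₁, …, xₙ` is a system of parameters of the local ring `R`: `n = dim R`, and the ideal
`(x₁, …, xₙ)` is primary to the maximal ideal (its radical is the maximal ideal). -/
def IsSystemOfParameters [IsLocalRing R] {n : ℕ} (x : Fin n → R) : Prop :=
  (n : WithBot ℕ∞) = ringKrullDim R ∧
    (Ideal.span (Set.range x)).radical = maximalIdeal R

/-- The depth of the local ring `R`: the supremum of the lengths of the `R`-regular sequences
contained in the maximal ideal. -/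
def depth (R : Type u) [CommRing R] [IsLocalRing R] : ℕ∞ :=
  ⨆ rs : {rs : List R // RingTheory.Sequence.IsRegular R rs ∧ ∀ r ∈ rs, r ∈ maximalIdeal R},
    (rs.1.length : ℕ∞)

/-- The Frobenius power `I^{[p^e]}`: the ideal generated by all `a ^ (p ^ e)` with `a ∈ I`. -/
def frobeniusPower (p : ℕ) (I : Ideal R) (e : ℕ) : Ideal R :=
  Ideal.span {b | ∃ a ∈ I, b = a ^ p ^ e}

/-- The Frobenius closure `I^F = {x ∈ R | ∃ e, x^{p^e} ∈ I^{[p^e]}}`. -/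
def frobeniusClosure (p : ℕ) (I : Ideal R) : Set R :=
  {x | ∃ e : ℕ, x ^ p ^ e ∈ frobeniusPower p I e}

/-- `I` is Frobenius closed: `I^F = I`. -/
def IsFrobeniusClosed (p : ℕ) (I : Ideal R) : Prop :=
  frobeniusClosure p I = (I : Set R)

end Ideals

section Action

variable (R : Type u) [CommRing R] (p : ℕ) [ExpChar R p]

/-- `F_* R`: the ring `R`, as an `R`-module by restriction of scalars along the Frobenius
endomorphism, so that `r` acts as multiplication by `r ^ p`. -/
abbrev frobeniusPushforward : ModuleCat.{u} R :=
  (ModuleCat.restrictScalars (frobenius R p)).obj (ModuleCat.of R R)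

/-- The Frobenius endomorphism `a ↦ a ^ p`, as an `R`-linear map `F : R ⟶ F_* R`. -/
def frobeniusHom : ModuleCat.of R R ⟶ frobeniusPushforward R p :=
  ModuleCat.ofHom (Y := frobeniusPushforward R p)
    { toFun := fun a => (frobenius R p a : R)
      map_add' := fun a b => map_add (frobenius R p) a b
      map_smul' := fun r a => map_mul (frobenius R p) r a }

/-- The action of Frobenius on the local cohomology `H^j_I(R)`, as the `R`-linear map
`H^j_I(F) : H^j_I(R) ⟶ H^j_I(F_* R)`. Its target is canonically the abelian group `H^j_I(R)`
with `r` acting as `r ^ p`, since `H^j_I(F_* R) = F_* H^j_{I^{[p]}}(R) = F_* H^j_I(R)`; under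
this identification it is the `p`-linear Frobenius action on `H^j_I(R)`. -/
def localCohomologyFrobenius (I : Ideal R) (j : ℕ) :
    (localCohomology I j).obj (ModuleCat.of R R) ⟶
      (localCohomology I j).obj (frobeniusPushforward R p) :=
  (localCohomology I j).map (frobeniusHom R p)

/-- Frobenius acts injectively on `H^j_m(R)`, where `m` is the maximal ideal of `R`. -/
def FrobeniusActsInjectively [IsLocalRing R] (j : ℕ) : Prop :=
  Function.Injective (localCohomologyFrobenius R p (maximalIdeal R) j)

end Action

end FrobeniusAction

end

/-! The argument gives injectivity in every degree `j ≤ dim R`; depth and dimension are special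
cases.

Prime avoidance provides a filter-regular system of parameters `x₁, …, x_d`
(`exists_isRegularAway_radical_eq`): modulo the preceding elements, each one has `𝔪`-power torsion
kernel, and this persists for powers of the elements. For `i ≤ j` and any exponents `nᵢ > 0`,
Frobenius `R/(xᵢ^nᵢ) → F_*(R/(xᵢ^(nᵢ p)))` is injective: powers of the remaining parameters complete
the ideal to a Frobenius closed one, and Krull's intersection theorem removes them again
(`isFrobeniusInjective_of_isFrobeniusClosed`). This is injectivity on `H⁰`, and `j` dimension shifts
carry it to `H^j(R) → H^j(F_* R)`. The shift `InjectiveInLimit.succ` asks for torsion kernels on the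
source only; it pays for this by comparing the quotients by `x^n` and `x^(2n)`.

Local cohomology is treated as the colimit of `Ext^j(R/𝔪^k, -)`, so that being zero means
restricting to zero at some later stage. The long exact sequences are those of `Abelian.Ext`, while
`localCohomology` uses the derived functor `Ext`; cocycles on a projective resolution connect the
two. -/

noncomputable section

namespace FrobeniusAction

open CategoryTheory IsLocalRing

universe u

/-! ### Regular sequences after inverting an element. -/

section FilterRegular

variable {R : Type u} [CommRing R]

/-- The sequence `x₁, …, xₙ` is regular on `R ⧸ I` after inverting `r`. -/
def IsRegularAway (r : R) : Ideal R → List R → Prop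
  | _, [] => True
  | I, x :: xs => (∀ a, x * a ∈ I → ∃ k : ℕ, r ^ k * a ∈ I) ∧
      IsRegularAway r (I ⊔ Ideal.span {x}) xs

/-- For all positive exponents, `x₁ ^ n₁, …, xₛ ^ nₛ` is regular on `R ⧸ I` after inverting `r`. -/
def IsPowRegularAway (r : R) : Ideal R → List R → Prop
  | _, [] => True
  | I, x :: xs => ∀ n : ℕ, 0 < n → (∀ a, x ^ n * a ∈ I → ∃ k : ℕ, r ^ k * a ∈ I) ∧
      IsPowRegularAway r (I ⊔ Ideal.span {x ^ n}) xs

lemma mem_sup_span_singleton {I : Ideal R} {x a : R} :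
    a ∈ I ⊔ Ideal.span {x} ↔ ∃ b, a - x * b ∈ I := by
  rw [Submodule.mem_sup]
  constructor
  · rintro ⟨y, hy, z, hz, rfl⟩
    obtain ⟨b, rfl⟩ := Ideal.mem_span_singleton'.1 hz
    exact ⟨b, by rwa [mul_comm x b, add_sub_cancel_right]⟩
  · rintro ⟨b, hb⟩
    exact ⟨_, hb, x * b, Ideal.mul_mem_right _ _ (Ideal.mem_span_singleton_self x), by ring⟩

/-- After inverting `r`, multiplication by `c` gives an exact sequence `0 → R/J₁ → R/J₂ → R/J₃ → 0`.
Regularity on the two ends passes to the middle, and since `x` is regular on `R/J₃` the sequence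
stays exact modulo `x`. -/
lemma IsRegularAway.of_extension {r c : R} {xs : List R} {J₁ J₂ J₃ : Ideal R}
    (h₁ : IsRegularAway r J₁ xs) (h₃ : IsRegularAway r J₃ xs)
    (h₁₂ : ∀ a ∈ J₁, c * a ∈ J₂) (h₂₃ : J₃ = J₂ ⊔ Ideal.span {c})
    (hker : ∀ a, c * a ∈ J₂ → ∃ k : ℕ, r ^ k * a ∈ J₁) :
    IsRegularAway r J₂ xs := by
  induction xs generalizing J₁ J₂ J₃ with
  | nil => trivial
  | cons x xs ih =>
    obtain ⟨h₁, h₁'⟩ := h₁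
    obtain ⟨h₃, h₃'⟩ := h₃
    have key : ∀ b, x * b ∈ J₂ ⊔ Ideal.span {c} →
        ∃ (k : ℕ) (a' : R), r ^ k * b - c * a' ∈ J₂ := fun b hb => by
      obtain ⟨k, hk⟩ := h₃ b (h₂₃ ▸ hb)
      rw [h₂₃, mem_sup_span_singleton] at hk
      obtain ⟨a', ha'⟩ := hk
      exact ⟨k, a', ha'⟩
    refine ⟨fun b hb => ?_, ih h₁' h₃' ?_ ?_ ?_⟩
    · obtain ⟨s, a, ha⟩ := key b (Ideal.mem_sup_left hb)
      have hxa : c * (x * a) ∈ J₂ := by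
        have := J₂.sub_mem (J₂.mul_mem_left (r ^ s) hb) (J₂.mul_mem_left x ha)
        convert this using 1
        ring
      obtain ⟨t, ht⟩ := hker _ hxa
      obtain ⟨w, hw⟩ := h₁ (r ^ t * a) (by convert ht using 1; ring)
      refine ⟨w + t + s, ?_⟩
      have := J₂.add_mem (J₂.mul_mem_left (r ^ (w + t)) ha) (h₁₂ _ hw)
      convert this using 1
      ring
    · intro a ha
      obtain ⟨b, hb⟩ := mem_sup_span_singleton.1 ha
      refine mem_sup_span_singleton.2 ⟨c * b, ?_⟩
      convert h₁₂ _ hb using 1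
      ring
    · rw [h₂₃, sup_assoc, sup_assoc, sup_comm (Ideal.span {c})]
    · intro a ha
      obtain ⟨b, hb⟩ := mem_sup_span_singleton.1 ha
      have hxb : x * b ∈ J₂ ⊔ Ideal.span {c} := by
        refine mem_sup_span_singleton.2 ⟨a, ?_⟩
        convert J₂.neg_mem hb using 1
        ring
      obtain ⟨s, a', ha'⟩ := key b hxb
      have : c * (r ^ s * a - x * a') ∈ J₂ := by
        have := J₂.add_mem (J₂.mul_mem_left (r ^ s) hb) (J₂.mul_mem_left x ha')
        convert this using 1
        ring
      obtain ⟨t, ht⟩ := hker _ this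
      refine ⟨t + s, mem_sup_span_singleton.2 ⟨r ^ t * a', ?_⟩⟩
      convert ht using 1
      ring

lemma exists_pow_mul_mem_of_pow_mul_mem {r x : R} {I : Ideal R}
    (hx : ∀ a, x * a ∈ I → ∃ k : ℕ, r ^ k * a ∈ I) (n : ℕ) (a : R) (ha : x ^ n * a ∈ I) :
    ∃ k : ℕ, r ^ k * a ∈ I := by
  induction n generalizing a with
  | zero => exact ⟨0, by simpa using ha⟩
  | succ n ih =>
    obtain ⟨k, hk⟩ := hx (x ^ n * a) (by convert ha using 1; ring)
    obtain ⟨l, hl⟩ := ih (r ^ k * a) (by convert hk using 1; ring)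
    exact ⟨l + k, by convert hl using 1; ring⟩

/-- Induction on `n`: multiplication by `x^n` makes `R/(I, x^(n+1))` an extension of `R/(I, x^n)` by
`R/(I, x)`, up to `r`-power torsion. -/
lemma IsRegularAway.sup_span_pow {r x : R} {xs : List R} {I : Ideal R}
    (h : IsRegularAway r I (x :: xs)) {n : ℕ} (hn : 0 < n) :
    IsRegularAway r (I ⊔ Ideal.span {x ^ n}) xs := by
  induction n, hn using Nat.le_induction with
  | base => simpa using h.2
  | succ n hn ih =>
    refine IsRegularAway.of_extension (c := x ^ n) h.2 ih ?_ ?_ ?_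
    · intro a ha
      obtain ⟨b, hb⟩ := mem_sup_span_singleton.1 ha
      refine mem_sup_span_singleton.2 ⟨b, ?_⟩
      convert I.mul_mem_left (x ^ n) hb using 1
      ring
    · have : Ideal.span {x ^ (n + 1)} ≤ Ideal.span {x ^ n} :=
        Ideal.span_singleton_le_span_singleton.2 (pow_dvd_pow x n.le_succ)
      rw [sup_assoc, sup_eq_right.2 this]
    · intro a ha
      obtain ⟨b, hb⟩ := mem_sup_span_singleton.1 ha
      obtain ⟨k, hk⟩ := exists_pow_mul_mem_of_pow_mul_mem h.1 n (a - x * b)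
        (by convert hb using 1; ring)
      refine ⟨k, mem_sup_span_singleton.2 ⟨r ^ k * b, ?_⟩⟩
      convert hk using 1
      ring

lemma IsRegularAway.isPowRegularAway {r : R} {xs : List R} {I : Ideal R}
    (h : IsRegularAway r I xs) : IsPowRegularAway r I xs := by
  induction xs generalizing I with
  | nil => trivial
  | cons x xs ih =>
    exact fun n hn => ⟨exists_pow_mul_mem_of_pow_mul_mem h.1 n, ih (h.sup_span_pow hn)⟩

lemma IsRegularAway.of_append_left {r : R} {xs ys : List R} {I : Ideal R}
    (h : IsRegularAway r I (xs ++ ys)) : IsRegularAway r I xs := by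
  induction xs generalizing I with
  | nil => trivial
  | cons x xs ih => exact ⟨h.1, ih h.2⟩

lemma IsRegularAway.append_singleton {r : R} {xs : List R} {x : R} {I : Ideal R}
    (h : IsRegularAway r I xs)
    (hx : ∀ a, x * a ∈ I ⊔ Ideal.ofList xs → ∃ k : ℕ, r ^ k * a ∈ I ⊔ Ideal.ofList xs) :
    IsRegularAway r I (xs ++ [x]) := by
  induction xs generalizing I with
  | nil => exact ⟨by simpa using hx, trivial⟩
  | cons y xs ih =>
    refine ⟨h.1, ih h.2 ?_⟩
    rwa [sup_assoc, ← Ideal.ofList_cons]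

/-- An element avoiding the associated primes of `R ⧸ I` that do not contain `r` is regular on
`R ⧸ I` after inverting `r`. -/
lemma exists_pow_mul_mem_of_notMem_associatedPrimes [IsNoetherianRing R] {I : Ideal R} {r x : R}
    (hx : ∀ P ∈ associatedPrimes R (R ⧸ I), r ∉ P → x ∉ P) (a : R) (ha : x * a ∈ I) :
    ∃ k : ℕ, r ^ k * a ∈ I := by
  by_contra! hcon
  let f : ℕ →o Ideal R :=
    ⟨fun n => I.colon {r ^ n}, fun n m hnm b hb => by
      rw [Submodule.mem_colon_singleton] at hb ⊢
      obtain ⟨c, hc⟩ := pow_dvd_pow r hnm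
      rw [hc, smul_eq_mul, ← mul_assoc]
      exact I.mul_mem_right _ hb⟩
  obtain ⟨n, hn⟩ := monotone_stabilizes_iff_noetherian.2 (inferInstance : IsNoetherian R R) f
  have hstep : ∀ b, r ^ (n + 1) * b ∈ I → r ^ n * b ∈ I := fun b hb => by
    have h1 : b ∈ f (n + 1) := Submodule.mem_colon_singleton.2 (by rwa [smul_eq_mul, mul_comm])
    rw [← hn (n + 1) n.le_succ] at h1
    simpa [mul_comm] using Submodule.mem_colon_singleton.1 h1
  -- Past the stable exponent, `y` is nonzero and `r` acts injectively on `R y`. An associated prime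
  -- of `R y` therefore avoids `r`, yet it contains `x` because `x * a ∈ I`.
  let y : R ⧸ I := Ideal.Quotient.mk I (r ^ n * a)
  let L : Submodule R (R ⧸ I) := Submodule.span R {y}
  have hy : y ≠ 0 := fun h => hcon n (Ideal.Quotient.eq_zero_iff_mem.1 h)
  have : Nontrivial L :=
    ⟨⟨⟨y, Submodule.mem_span_singleton_self y⟩, 0, fun h => hy (congrArg Subtype.val h)⟩⟩
  obtain ⟨P, hP⟩ := associatedPrimes.nonempty R L
  obtain ⟨hPp, ⟨b, hb⟩, hPb⟩ := isAssociatedPrime_iff.1 hP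
  obtain ⟨s, rfl⟩ := Submodule.mem_span_singleton.1 hb
  have hmem : ∀ t : R, t ∈ P ↔ t * (s * (r ^ n * a)) ∈ I := fun t => by
    rw [hPb]
    simp only [Submodule.mem_colon_singleton, Submodule.mem_bot, SetLike.mk_smul_mk,
      Submodule.mk_eq_zero, y, Algebra.smul_def]
    rw [← Ideal.Quotient.eq_zero_iff_mem]
    rfl
  have hPA : P ∈ associatedPrimes R (R ⧸ I) :=
    associatedPrimes.subset_of_injective (f := L.subtype) L.subtype_injective hP
  refine hx P hPA (fun hr => hPp.ne_top ?_) ?_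
  · rw [Ideal.eq_top_iff_one, hmem]
    have := hstep (s * a) (by convert (hmem r).1 hr using 1; ring)
    convert this using 1
    ring
  · rw [hmem]
    convert I.mul_mem_left (s * r ^ n) ha using 1
    ring

end FilterRegular

/-! ### Filter-regular systems of parameters. -/

section Parameters

variable {R : Type u} [CommRing R] [IsLocalRing R] [IsNoetherianRing R]

/-- Any ideal admits an element of `𝔪` outside all its associated primes other than `𝔪`. -/
lemma exists_mem_maximalIdeal_notMem_associatedPrimes (I : Ideal R) :
    ∃ x ∈ maximalIdeal R, ∀ P ∈ associatedPrimes R (R ⧸ I), P ≠ maximalIdeal R → x ∉ P := by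
  by_contra! h
  let S := {P ∈ associatedPrimes R (R ⧸ I) | P ≠ maximalIdeal R}
  have hfin : S.Finite := (associatedPrimes.finite R (R ⧸ I)).subset fun _ h => h.1
  obtain ⟨P, ⟨hP, hne⟩, hle⟩ :=
    ((maximalIdeal R).subset_union_prime_finite hfin (f := id) 0 0 fun _ h _ _ => h.1.1).1
      fun x hx => by
        obtain ⟨P, hP, hne, hxP⟩ := h x hx
        exact Set.mem_biUnion (x := P) ⟨hP, hne⟩ hxP
  exact hne ((maximalIdeal.isMaximal R).eq_of_le hP.1.ne_top hle).symm

/-- There are arbitrarily long filter-regular sequences in `𝔪`, and the non-maximal primes that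
contain the first `n` elements have height at least `n`. -/
lemma exists_isRegularAway_le_height (n : ℕ) :
    ∃ xs : List R, xs.length = n ∧ (∀ x ∈ xs, x ∈ maximalIdeal R) ∧
      (∀ r ∈ maximalIdeal R, IsRegularAway r ⊥ xs) ∧
      ∀ P : Ideal R, P.IsPrime → P ≠ maximalIdeal R → Ideal.ofList xs ≤ P →
        (n : ℕ∞) ≤ P.height := by
  induction n with
  | zero => exact ⟨[], rfl, by simp, fun _ _ => trivial, by simp⟩
  | succ n ih =>
    obtain ⟨xs, hlen, hmem, hreg, hht⟩ := ih
    obtain ⟨x, hx, hxP⟩ := exists_mem_maximalIdeal_notMem_associatedPrimes (Ideal.ofList xs)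
    refine ⟨xs ++ [x], by simp [hlen], ?_, ?_, ?_⟩
    · simpa [or_imp, forall_and] using ⟨hmem, hx⟩
    · refine fun r hr => (hreg r hr).append_singleton ?_
      rw [bot_sup_eq]
      exact exists_pow_mul_mem_of_notMem_associatedPrimes fun P hP hrP =>
        hxP P hP fun h => hrP (h ▸ hr)
    · intro P hP hne hle
      rw [Ideal.ofList_append, Ideal.ofList_singleton, sup_le_iff,
        Ideal.span_singleton_le_iff_mem] at hle
      -- `Q` is a nonmaximal associated prime of the shorter ideal, so `x ∉ Q`; hence `Q < P` and
      -- the height grows by one.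
      obtain ⟨Q, hQ, hQP⟩ := Ideal.exists_minimalPrimes_le hle.1
      have hQp : Q.IsPrime := hQ.1.1
      have hQne : Q ≠ maximalIdeal R := fun h =>
        hne ((maximalIdeal.isMaximal R).eq_of_le hP.ne_top (h ▸ hQP)).symm
      have hQA : Q ∈ associatedPrimes R (R ⧸ Ideal.ofList xs) := by
        apply Module.associatedPrimes.minimalPrimes_annihilator_subset_associatedPrimes
        rwa [Ideal.annihilator_quotient]
      have hlt : Q < P := lt_of_le_of_ne hQP fun h => hxP Q hQA hQne (h ▸ hle.2)
      have := Ideal.height_add_one_le_of_lt_of_isPrime hlt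
      push_cast
      exact (add_le_add_left (hht Q hQp hQne hQ.1.2) 1).trans this

/-- Every Noetherian local ring has a filter-regular system of parameters. -/
lemma exists_isRegularAway_radical_eq {d : ℕ} (hd : (d : WithBot ℕ∞) = ringKrullDim R) :
    ∃ xs : List R, xs.length = d ∧ (∀ x ∈ xs, x ∈ maximalIdeal R) ∧
      (∀ r ∈ maximalIdeal R, IsRegularAway r ⊥ xs) ∧
      (Ideal.ofList xs).radical = maximalIdeal R := by
  obtain ⟨xs, hlen, hmem, hreg, hht⟩ := exists_isRegularAway_le_height (R := R) d
  refine ⟨xs, hlen, hmem, hreg, le_antisymm ?_ ?_⟩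
  · exact (maximalIdeal.isMaximal R).isPrime.radical_le_iff.2 (Ideal.span_le.2 hmem)
  · rw [Ideal.radical_eq_sInf]
    refine le_sInf fun P ⟨hle, hP⟩ => ?_
    by_contra hP'
    have hne : P ≠ maximalIdeal R := fun h => hP' h.ge
    have hlt : P < maximalIdeal R := lt_of_le_of_ne (le_maximalIdeal hP.ne_top) hne
    have h1 := Ideal.height_add_one_le_of_lt_of_isPrime hlt
    have h2 : (maximalIdeal R).height = d := by
      have := IsLocalRing.maximalIdeal_height_eq_ringKrullDim (R := R)
      rw [← hd] at this
      exact_mod_cast this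
    rw [h2] at h1
    have h3 := (add_le_add_left (hht P hP hne hle) 1).trans h1
    norm_cast at h3
    omega

end Parameters

/-! ### Injectivity of Frobenius modulo part of a system of parameters. -/

section FrobeniusInjective

variable {R : Type u} [CommRing R]

/-- For all positive exponents, the map `a ↦ a ^ p` from `R ⧸ (I, x₁ ^ n₁, …, xₛ ^ nₛ)` to
`R ⧸ (J, x₁ ^ (n₁ p), …, xₛ ^ (nₛ p))` is injective. -/
def IsFrobeniusInjective (p : ℕ) : Ideal R → Ideal R → List R → Prop
  | I, J, [] => ∀ a, a ^ p ∈ J → a ∈ I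
  | I, J, x :: xs => ∀ n : ℕ, 0 < n →
      IsFrobeniusInjective p (I ⊔ Ideal.span {x ^ n}) (J ⊔ Ideal.span {(x ^ n) ^ p}) xs

lemma radical_sup_congr {I J K L : Ideal R} (h₁ : I.radical = K.radical)
    (h₂ : J.radical = L.radical) : (I ⊔ J).radical = (K ⊔ L).radical := by
  rw [Ideal.radical_sup, h₁, h₂, ← Ideal.radical_sup]

lemma radical_span_singleton_pow (x : R) {n : ℕ} (hn : 0 < n) :
    (Ideal.span {x ^ n}).radical = (Ideal.span {x}).radical := by
  rw [← Ideal.span_singleton_pow, Ideal.radical_pow _ hn.ne']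

lemma radical_ofList_map_pow (xs : List R) {n : ℕ} (hn : 0 < n) :
    (Ideal.ofList (xs.map (· ^ n))).radical = (Ideal.ofList xs).radical := by
  induction xs with
  | nil => simp
  | cons x xs ih =>
    rw [List.map_cons, Ideal.ofList_cons, Ideal.ofList_cons]
    exact radical_sup_congr (radical_span_singleton_pow x hn) ih

lemma ofList_map_pow_le_pow {I : Ideal R} {xs : List R} (h : ∀ x ∈ xs, x ∈ I) (n : ℕ) :
    Ideal.ofList (xs.map (· ^ n)) ≤ I ^ n := by
  refine Ideal.span_le.2 fun y hy => ?_
  obtain ⟨x, hx, rfl⟩ := List.mem_map.1 hy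
  exact Ideal.pow_mem_pow (h x hx) n

variable [IsLocalRing R] {p : ℕ}

lemma isFrobeniusClosed_ofList
    (hR : ∀ (n : ℕ) (x : Fin n → R), IsSystemOfParameters x →
      IsFrobeniusClosed p (Ideal.span (Set.range x)))
    {xs : List R} (hlen : (xs.length : WithBot ℕ∞) = ringKrullDim R)
    (hrad : (Ideal.ofList xs).radical = maximalIdeal R) :
    IsFrobeniusClosed p (Ideal.ofList xs) := by
  have h : Set.range xs.get = {r | r ∈ xs} := Set.range_list_get xs
  have := hR _ xs.get ⟨hlen, by rw [h]; exact hrad⟩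
  rwa [h] at this

variable [IsNoetherianRing R]

/-- Krull's intersection theorem for `R ⧸ I`. -/
lemma mem_of_forall_mem_sup_pow {I : Ideal R} {a : R}
    (h : ∀ n : ℕ, 0 < n → a ∈ I ⊔ maximalIdeal R ^ n) : a ∈ I := by
  by_cases hI : I = ⊤
  · simp [hI]
  rw [← Ideal.Quotient.eq_zero_iff_mem, ← Submodule.mem_bot R,
    ← Ideal.iInf_pow_smul_eq_bot_of_isLocalRing (M := R ⧸ I) (maximalIdeal R)
      (maximalIdeal.isMaximal R).ne_top, Submodule.mem_iInf]
  intro n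
  rcases n.eq_zero_or_pos with rfl | hn
  · simp
  obtain ⟨y, hy, z, hz, rfl⟩ := Submodule.mem_sup.1 (h n hn)
  have : Ideal.Quotient.mk I (y + z) = z • (1 : R ⧸ I) := by
    rw [map_add, Ideal.Quotient.eq_zero_iff_mem.2 hy, zero_add, Algebra.smul_def, mul_one]
    rfl
  rw [this]
  exact Submodule.smul_mem_smul hz trivial

/-- `ls` collects the powers already chosen and `ys` the parameters left over. Since `ls` together
with `ys^n` is again a system of parameters, `a^p ∈ (ls^p)` puts `a` in `(ls) + 𝔪^n` for every `n >
0`. -/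
lemma isFrobeniusInjective_of_isFrobeniusClosed
    (hR : ∀ (n : ℕ) (x : Fin n → R), IsSystemOfParameters x →
      IsFrobeniusClosed p (Ideal.span (Set.range x)))
    (ls xs ys : List R) (hys : ∀ y ∈ ys, y ∈ maximalIdeal R)
    (hlen : ((ls ++ (xs ++ ys)).length : WithBot ℕ∞) = ringKrullDim R)
    (hrad : (Ideal.ofList ls ⊔ Ideal.ofList (xs ++ ys)).radical = maximalIdeal R) :
    IsFrobeniusInjective p (Ideal.ofList ls) (Ideal.ofList (ls.map (· ^ p))) xs := by
  induction xs generalizing ls with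
  | nil =>
    refine fun a ha => mem_of_forall_mem_sup_pow fun n hn => ?_
    have hclosed := isFrobeniusClosed_ofList hR (xs := ls ++ ys.map (· ^ n))
      (by simpa using hlen) (by
        rw [Ideal.ofList_append, ← hrad]
        exact radical_sup_congr rfl (radical_ofList_map_pow ys hn))
    have hmem : a ∈ frobeniusClosure p (Ideal.ofList (ls ++ ys.map (· ^ n))) := by
      refine ⟨1, ?_⟩
      rw [pow_one]
      refine Ideal.span_le.2 (fun y hy => ?_) ha
      obtain ⟨x, hx, rfl⟩ := List.mem_map.1 hy
      exact Ideal.subset_span ⟨x, Ideal.subset_span (List.mem_append_left _ hx), by rw [pow_one]⟩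
    rw [hclosed, Ideal.ofList_append] at hmem
    exact sup_le_sup_left (ofList_map_pow_le_pow hys n) _ hmem
  | cons x xs ih =>
    intro n hn
    have := ih (ls ++ [x ^ n]) (by simpa [add_assoc, add_comm, add_left_comm] using hlen) (by
      rw [← hrad, Ideal.ofList_append, Ideal.ofList_singleton, List.cons_append,
        Ideal.ofList_cons, ← sup_assoc]
      exact radical_sup_congr
        (radical_sup_congr rfl (radical_span_singleton_pow x hn)) rfl)
    simpa [Ideal.ofList_append] using this

end FrobeniusInjective

/-! ### Direct limits of `Ext` and power torsion. -/

section Torsion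

open Abelian

variable {R : Type u} [CommRing R] (I : Ideal R)

/-- The `R`-module `R ⧸ I ^ k`. -/
abbrev quotientPow (k : ℕ) : ModuleCat.{u} R := ModuleCat.of R (R ⧸ I ^ k)

/-- The projection `R ⧸ I ^ l ⟶ R ⧸ I ^ k` for `k ≤ l`. -/
def quotientPowMap {k l : ℕ} (h : k ≤ l) : quotientPow I l ⟶ quotientPow I k :=
  ModuleCat.ofHom (Submodule.mapQ (I ^ l) (I ^ k) LinearMap.id (Ideal.pow_le_pow_right h))

lemma quotientPowMap_comp {k l m : ℕ} (h : k ≤ l) (h' : l ≤ m) :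
    quotientPowMap I h' ≫ quotientPowMap I h = quotientPowMap I (h.trans h') := by
  ext
  rfl

variable {I}

/-- A class in `Ext^j(R ⧸ I ^ k, M)` vanishes in the limit if its restriction to some
`Ext^j(R ⧸ I ^ l, M)` is zero. -/
def VanishesInLimit {M : ModuleCat.{u} R} {j k : ℕ} (ξ : Ext (quotientPow I k) M j) : Prop :=
  ∃ (l : ℕ) (h : k ≤ l), (Ext.mk₀ (quotientPowMap I h)).comp ξ (zero_add j) = 0

variable (I) in
/-- `f` induces an injective map on the direct limits of `Ext^j(R ⧸ I ^ k, -)`. -/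
def InjectiveInLimit {M N : ModuleCat.{u} R} (f : M ⟶ N) (j : ℕ) : Prop :=
  ∀ (k : ℕ) (ξ : Ext (quotientPow I k) M j), ξ.comp (Ext.mk₀ f) (add_zero j) = 0 →
    VanishesInLimit ξ

lemma VanishesInLimit.comp {M N : ModuleCat.{u} R} {i j k m : ℕ} {ξ : Ext (quotientPow I k) M i}
    (h : VanishesInLimit ξ) (α : Ext M N j) (hm : i + j = m) :
    VanishesInLimit (ξ.comp α hm) := by
  obtain ⟨l, hl, h⟩ := h
  refine ⟨l, hl, ?_⟩
  rw [← Ext.comp_assoc _ _ _ (zero_add i) hm (by omega), h, Ext.zero_comp]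

lemma VanishesInLimit.of_restrict {M : ModuleCat.{u} R} {j k l : ℕ}
    {ξ : Ext (quotientPow I k) M j} (hkl : k ≤ l)
    (h : VanishesInLimit ((Ext.mk₀ (quotientPowMap I hkl)).comp ξ (zero_add j))) :
    VanishesInLimit ξ := by
  obtain ⟨m, hm, h⟩ := h
  refine ⟨m, hkl.trans hm, ?_⟩
  rwa [← Ext.comp_assoc _ _ _ (zero_add 0) (zero_add j) (by omega), Ext.mk₀_comp_mk₀,
    quotientPowMap_comp] at h

/-- Used to pass from `R ⧸ ⊥` back to `R`; nothing is needed of `b`. -/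
lemma InjectiveInLimit.of_comm {M N M' N' : ModuleCat.{u} R} {f : M ⟶ N} {f' : M' ⟶ N'} {j : ℕ}
    (h : InjectiveInLimit I f j) (a : M' ≅ M) (b : N' ⟶ N) (comm : a.hom ≫ f = f' ≫ b) :
    InjectiveInLimit I f' j := by
  intro k ξ hξ
  have h1 : VanishesInLimit (ξ.comp (Ext.mk₀ a.hom) (add_zero j)) := by
    apply h
    rw [Ext.comp_assoc_of_third_deg_zero, Ext.mk₀_comp_mk₀, comm, ← Ext.mk₀_comp_mk₀,
      ← Ext.comp_assoc_of_third_deg_zero, hξ, Ext.zero_comp]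
  have h2 := h1.comp (Ext.mk₀ a.inv) (add_zero j)
  rwa [Ext.comp_assoc_of_third_deg_zero, Ext.mk₀_comp_mk₀, a.hom_inv_id, Ext.comp_mk₀_id] at h2

variable (I) in
/-- The submodule of elements killed by a power of `I`. -/
def powerTorsion (M : Type u) [AddCommGroup M] [Module R M] : Submodule R M where
  carrier := {m | ∃ k : ℕ, ∀ r ∈ I ^ k, r • m = 0}
  zero_mem' := ⟨0, fun r _ => smul_zero r⟩
  add_mem' := by
    rintro a b ⟨k, hk⟩ ⟨l, hl⟩
    refine ⟨max k l, fun r hr => ?_⟩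
    rw [smul_add, hk r (Ideal.pow_le_pow_right (le_max_left k l) hr),
      hl r (Ideal.pow_le_pow_right (le_max_right k l) hr), add_zero]
  smul_mem' := by
    rintro c m ⟨k, hk⟩
    exact ⟨k, fun r hr => by rw [smul_comm, hk r hr, smul_zero]⟩

lemma exists_pow_smul_eq_zero_of_fg {M : Type u} [AddCommGroup M] [Module R M]
    {L : Submodule R M} (hL : L.FG) (h : L ≤ powerTorsion I M) :
    ∃ k : ℕ, ∀ r ∈ I ^ k, ∀ m ∈ L, r • m = 0 := by
  obtain ⟨s, rfl⟩ := hL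
  choose! k hk using fun m (hm : m ∈ s) => h (Submodule.subset_span hm)
  refine ⟨s.sup k, fun r hr m hm => ?_⟩
  have : Submodule.span R (s : Set M) ≤ LinearMap.ker (LinearMap.lsmul R M r) :=
    Submodule.span_le.2 fun m hm =>
      hk m hm r (Ideal.pow_le_pow_right (Finset.le_sup hm) hr)
  exact this hm

/-- The `I`-power torsion submodule of an injective module is injective. -/
lemma injective_powerTorsion [IsNoetherianRing R] (E : Type u) [AddCommGroup E] [Module R E]
    [Module.Injective R E] : Module.Injective R (powerTorsion I E) := by
  refine Module.Baer.injective fun J g => ?_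
  let g' : J →ₗ[R] E := (powerTorsion I E).subtype ∘ₗ g
  have hfg : (LinearMap.range g').FG := Module.Finite.iff_fg.1 inferInstance
  obtain ⟨s, hs⟩ := exists_pow_smul_eq_zero_of_fg (I := I) hfg (by
    rintro _ ⟨m, rfl⟩
    exact (g m).2)
  obtain ⟨c, hc⟩ := Ideal.exists_pow_inf_eq_pow_smul I (J : Submodule R R)
  -- By Artin–Rees, `J ∩ I^(c+s) ⊆ I^s J`, and `I^s` annihilates the finitely generated range of
  -- `g'`.
  have hker : ∀ y : J, (y : R) ∈ I ^ (c + s) → g' y = 0 := by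
    intro y hy
    have h1 : (y : R) ∈ I ^ (c + s) • (⊤ : Submodule R R) ⊓ J :=
      ⟨by simpa using hy, y.2⟩
    rw [hc _ (Nat.le_add_right c s), Nat.add_sub_cancel_left] at h1
    have h2 : I ^ s • (I ^ c • (⊤ : Submodule R R) ⊓ J) ≤
        (LinearMap.ker g').map (J : Submodule R R).subtype := by
      refine Submodule.smul_le.2 fun r hr n hn => ?_
      refine ⟨r • ⟨n, hn.2⟩, ?_, rfl⟩
      rw [SetLike.mem_coe, LinearMap.mem_ker, map_smul]
      exact hs r hr _ ⟨_, rfl⟩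
    obtain ⟨z, hz, hzy⟩ := h2 h1
    rwa [Subtype.ext hzy] at hz
  let ι : J →ₗ[R] R ⧸ I ^ (c + s) := (Submodule.mkQ (I ^ (c + s))) ∘ₗ (J : Submodule R R).subtype
  have hι : LinearMap.ker ι ≤ LinearMap.ker g' := fun y hy =>
    hker y ((Submodule.Quotient.mk_eq_zero _).1 hy)
  -- Extending to `R ⧸ I^(c+s)` instead of `R` forces the image of `1` to be `I`-power torsion.
  obtain ⟨H, hH⟩ := Module.Injective.out ((LinearMap.ker ι).liftQ ι le_rfl)
    (LinearMap.ker_eq_bot.1 (Submodule.ker_liftQ_eq_bot _ _ _ le_rfl))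
    ((LinearMap.ker ι).liftQ g' hι)
  have hH' : ∀ r : R, r • H (Submodule.Quotient.mk 1) = H (Submodule.Quotient.mk r) := fun r => by
    rw [← map_smul, ← Submodule.Quotient.mk_smul, smul_eq_mul, mul_one]
  refine ⟨LinearMap.toSpanSingleton R _ ⟨H (Submodule.Quotient.mk 1), c + s, fun r hr => ?_⟩,
    fun y hy => Subtype.ext ?_⟩
  · rw [hH', (Submodule.Quotient.mk_eq_zero _).2 hr, map_zero]
  · rw [LinearMap.toSpanSingleton_apply]
    exact (hH' y).trans (hH (Submodule.Quotient.mk ⟨y, hy⟩))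

end Torsion

/-! ### Vanishing for power torsion modules. -/

section Limit

open Abelian

variable {R : Type u} [CommRing R] {I : Ideal R}

/-- The short complex of modules attached to an exact pair of linear maps. -/
abbrev exactShortComplex {A B C : Type u} [AddCommGroup A] [Module R A] [AddCommGroup B]
    [Module R B] [AddCommGroup C] [Module R C] {f : A →ₗ[R] B} {g : B →ₗ[R] C}
    (h : Function.Exact f g) : ShortComplex (ModuleCat.{u} R) :=
  ShortComplex.mk (ModuleCat.ofHom f) (ModuleCat.ofHom g)
    (ModuleCat.hom_ext h.linearMap_comp_eq_zero)

lemma exactShortComplex_shortExact {A B C : Type u} [AddCommGroup A] [Module R A]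
    [AddCommGroup B] [Module R B] [AddCommGroup C] [Module R C] {f : A →ₗ[R] B} {g : B →ₗ[R] C}
    (h : Function.Exact f g) (hf : Function.Injective f) (hg : Function.Surjective g) :
    (exactShortComplex h).ShortExact where
  exact := (ShortComplex.moduleCat_exact_iff _).2 fun x hx => (h x).1 hx
  mono_f := (ModuleCat.mono_iff_injective _).2 hf
  epi_g := (ModuleCat.epi_iff_surjective _).2 hg

lemma hom_quotientPow_ext {M : Type u} [AddCommGroup M] [Module R M] {k : ℕ}
    {f g : quotientPow I k ⟶ ModuleCat.of R M}
    (h : f.hom (Submodule.Quotient.mk 1) = g.hom (Submodule.Quotient.mk 1)) : f = g := by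
  refine ModuleCat.hom_ext (LinearMap.ext fun x => ?_)
  obtain ⟨r, rfl⟩ := Submodule.Quotient.mk_surjective _ x
  have : (Submodule.Quotient.mk r : R ⧸ I ^ k) = r • Submodule.Quotient.mk 1 := by
    rw [← Submodule.Quotient.mk_smul, smul_eq_mul, mul_one]
  rw [this]
  exact (map_smul f.hom _ _).trans (h ▸ (map_smul g.hom _ _).symm)

/-- Local cohomology of `I`-power torsion modules vanishes in positive degrees. -/
lemma vanishesInLimit_of_powerTorsion_eq_top [IsNoetherianRing R] {j k : ℕ} (T : Type u)
    [AddCommGroup T] [Module R T] (hT : powerTorsion I T = ⊤)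
    (ξ : Ext (quotientPow I k) (ModuleCat.of R T) (j + 1)) : VanishesInLimit ξ := by
  have := ModuleCat.enoughInjectives.{u} R
  let E := Injective.under (ModuleCat.of R T)
  have : Module.Injective R E := 
    @Module.injective_module_of_injective_object R E _ _ _
      (inferInstanceAs (Injective (Injective.under (ModuleCat.of R T))))
  let Γ := powerTorsion I E
  have : Module.Injective R Γ := injective_powerTorsion E
  have hΓ : Injective (ModuleCat.of R Γ) := Module.injective_object_of_injective_module R Γ
  let e : T →ₗ[R] E := (Injective.ι (ModuleCat.of R T)).hom
  have he : Function.Injective e := (ModuleCat.mono_iff_injective _).1 inferInstance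
  let ι : T →ₗ[R] Γ := e.codRestrict Γ fun t => by
    obtain ⟨k, hk⟩ := hT.ge (Submodule.mem_top (x := t))
    exact ⟨k, fun r hr => by rw [← map_smul, hk r hr, map_zero]⟩
  have hι : Function.Injective ι := fun a b h => he (congrArg Subtype.val h)
  have hex : Function.Exact ι (LinearMap.range ι).mkQ := LinearMap.exact_map_mkQ_range ι
  have hS := exactShortComplex_shortExact hex hι (Submodule.mkQ_surjective _)
  -- As `Γ` is injective, `ξ` is the connecting image of a class of degree `j` in `Γ/T`. That
  -- quotient is again torsion, so the degree descends to zero.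
  obtain ⟨ζ, rfl⟩ := Ext.covariant_sequence_exact₁ _ hS ξ
    (@Ext.eq_zero_of_injective _ _ _ _ _ _ _ hΓ _) rfl
  have hex1 : ∀ x : Γ, ∃ k : ℕ, ∀ r ∈ I ^ k, r • x = 0 := fun x => by
    obtain ⟨k, hk⟩ := x.2
    exact ⟨k, fun r hr => Subtype.ext (hk r hr)⟩
  cases j with
  | succ j =>
    refine (vanishesInLimit_of_powerTorsion_eq_top (Γ ⧸ LinearMap.range ι) ?_ ζ).comp _ _
    refine eq_top_iff.2 fun x _ => ?_
    obtain ⟨x, rfl⟩ := Submodule.mkQ_surjective _ x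
    obtain ⟨k, hk⟩ := hex1 x
    exact ⟨k, fun r hr => by rw [← map_smul, hk r hr, map_zero]⟩
  | zero =>
    obtain ⟨f, rfl⟩ := (Ext.mk₀_bijective _ _).2 ζ
    -- A lift of the image of `1` to `Γ` is killed by some `I^l`, so after restriction `f` itself
    -- lifts to `Γ` and its connecting image is zero.
    obtain ⟨x, hx⟩ := Submodule.mkQ_surjective _ (f.hom (Submodule.Quotient.mk 1))
    obtain ⟨l, hl⟩ := hex1 x
    let g : quotientPow I (max k l) ⟶ ModuleCat.of R Γ :=
      ModuleCat.ofHom ((I ^ max k l).liftQ (LinearMap.toSpanSingleton R Γ x) fun r hr =>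
        hl r (Ideal.pow_le_pow_right (le_max_right k l) hr))
    refine ⟨max k l, le_max_left k l, ?_⟩
    have hg : quotientPowMap I (le_max_left k l) ≫ f = g ≫ (exactShortComplex hex).g := by
      refine hom_quotientPow_ext ?_
      refine Eq.trans ?_ (hx.symm.trans ?_)
      · rfl
      · exact congrArg (Submodule.mkQ _) (one_smul R x).symm
    rw [← Ext.comp_assoc _ _ _ (zero_add 0) (zero_add 1) (by omega), Ext.mk₀_comp_mk₀, hg,
      ← Ext.mk₀_comp_mk₀, Ext.comp_assoc _ _ _ (zero_add 0) (zero_add 1) (by omega),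
      hS.comp_extClass, Ext.comp_zero]
termination_by j

end Limit

/-! ### Dimension shifting. -/

section Limit

open Abelian

variable {R : Type u} [CommRing R] {I : Ideal R}

/-- The short complex of a morphism of modules and its kernel. -/
abbrev kernelShortComplex {B C : ModuleCat.{u} R} (g : B ⟶ C) : ShortComplex (ModuleCat.{u} R) :=
  ShortComplex.mk (ModuleCat.ofHom (LinearMap.ker g.hom).subtype) g
    (ModuleCat.hom_ext (LinearMap.ext fun x => x.2))

lemma kernelShortComplex_shortExact {B C : ModuleCat.{u} R} {g : B ⟶ C}
    (hg : Function.Surjective g.hom) : (kernelShortComplex g).ShortExact where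
  exact := (ShortComplex.moduleCat_exact_iff _).2 fun x hx => ⟨⟨x, hx⟩, rfl⟩
  mono_f := (ModuleCat.mono_iff_injective _).2 Subtype.val_injective
  epi_g := (ModuleCat.epi_iff_surjective _).2 hg

/-- A commutative square induces a morphism between the short complexes of kernels. -/
abbrev kernelShortComplexMap {B C B' C' : ModuleCat.{u} R} {g : B ⟶ C} {g' : B' ⟶ C'}
    (b : B ⟶ B') (c : C ⟶ C') (h : b ≫ g' = g ≫ c) :
    kernelShortComplex g ⟶ kernelShortComplex g' where
  τ₁ := ModuleCat.ofHom (b.hom.restrict fun x (hx : g.hom x = 0) => by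
    have : g'.hom (b.hom x) = c.hom (g.hom x) := congr($h x)
    rw [LinearMap.mem_ker, this, hx, map_zero])
  τ₂ := b
  τ₃ := c
  comm₁₂ := rfl
  comm₂₃ := h

lemma comp_mk₀_smul_id_eq_zero {Y : ModuleCat.{u} R} {i k : ℕ} (ω : Ext (quotientPow I k) Y i)
    {r : R} (hr : r ∈ I ^ k) : ω.comp (Ext.mk₀ (r • 𝟙 Y)) (add_zero i) = 0 := by
  have h : r ∈ Module.annihilator R (quotientPow I k) := by
    rwa [Ideal.annihilator_quotient]
  exact congr($(Ext.postcomp_smul_id_eq_zero_of_mem_annihilator (M := Y) h i) ω)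

/-- Dimension shifting along an element `x ∈ I`: if `0 :_M x ^ n` is `I`-power torsion for all
`n`, and the maps `M ⧸ x ^ n M ⟶ N ⧸ x ^ n N` induced by `f` are injective on `H^j_I`, then `f`
is injective on `H^{j + 1}_I`. -/
lemma InjectiveInLimit.succ [IsNoetherianRing R] {x : R} (hx : x ∈ I) {M N : ModuleCat.{u} R}
    {f : M ⟶ N} {Mq Nq : ℕ → ModuleCat.{u} R} (π : ∀ n, M ⟶ Mq n) (ρ : ∀ n, N ⟶ Nq n)
    (fq : ∀ n, Mq n ⟶ Nq n) (hπ : ∀ n, Function.Surjective (π n).hom)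
    (hρ : ∀ n, Function.Surjective (ρ n).hom)
    (hπk : ∀ n m, (π n).hom m = 0 ↔ ∃ m', x ^ n • m' = m)
    (hρk : ∀ n m, (ρ n).hom m = 0 ↔ ∃ m', x ^ n • m' = m)
    (comm : ∀ n, f ≫ ρ n = π n ≫ fq n)
    (htors : ∀ n : ℕ, 0 < n → ∀ m : M, x ^ n • m = 0 → m ∈ powerTorsion I M) {j : ℕ}
    (h : ∀ n : ℕ, 0 < n → InjectiveInLimit I (fq n) j) : InjectiveInLimit I f (j + 1) := by
  have hlift : ∀ {L : ModuleCat.{u} R} (Lq : ℕ → ModuleCat.{u} R) (σ : ∀ n, L ⟶ Lq n)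
      (_ : ∀ n, Function.Surjective (σ n).hom)
      (_ : ∀ n m, (σ n).hom m = 0 ↔ ∃ m', x ^ n • m' = m) (n : ℕ),
      ∃ μ : Lq n ⟶ Lq (n + n), σ n ≫ μ = (x ^ n • 𝟙 L) ≫ σ (n + n) := by
    intro L Lq σ hσ hσk n
    have hS := kernelShortComplex_shortExact (hσ n)
    have := hS.epi_g
    refine ⟨hS.exact.desc ((x ^ n • 𝟙 L) ≫ σ (n + n)) ?_, hS.exact.g_desc _ _⟩
    refine ModuleCat.hom_ext (LinearMap.ext fun y => ?_)
    obtain ⟨m', hm'⟩ := (hσk n y.1).1 y.2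
    refine (hσk (n + n) _).2 ⟨m', ?_⟩
    rw [pow_add, mul_smul, hm']
    rfl
  intro k ξ hξ
  -- The shift by one keeps `n` positive when `k = 0`; `x^n` still annihilates `R ⧸ I^k`.
  let n := k + 1
  have hn : 0 < n := k.succ_pos
  have hxn : x ^ n ∈ I ^ k := Ideal.pow_le_pow_right k.le_succ (Ideal.pow_mem_pow hx n)
  obtain ⟨μ, hμ⟩ := hlift Mq π hπ hπk n
  obtain ⟨ν, hν⟩ := hlift Nq ρ hρ hρk n
  have hμν : μ ≫ fq (n + n) = fq n ≫ ν := by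
    have := (ModuleCat.epi_iff_surjective _).2 (hπ n)
    rw [← cancel_epi (π n), reassoc_of% hμ, ← comm, ← reassoc_of% comm n, hν]
    simp
  have hS := kernelShortComplex_shortExact (hπ n)
  have hS' := kernelShortComplex_shortExact (hπ (n + n))
  have hT := kernelShortComplex_shortExact (hρ n)
  let q : M ⟶ (kernelShortComplex (π n)).X₁ :=
    ModuleCat.ofHom ((LinearMap.lsmul R M (x ^ n)).codRestrict (LinearMap.ker (π n).hom)
      fun m => (hπk n _).2 ⟨m, rfl⟩)
  let q' : N ⟶ (kernelShortComplex (ρ n)).X₁ :=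
    ModuleCat.ofHom ((LinearMap.lsmul R N (x ^ n)).codRestrict (LinearMap.ker (ρ n).hom)
      fun m => (hρk n _).2 ⟨m, rfl⟩)
  let F := kernelShortComplexMap f (fq n) (comm n)
  let X := kernelShortComplexMap (x ^ n • 𝟙 M) μ hμ.symm
  have hq : q ≫ (kernelShortComplex (π n)).f = x ^ n • 𝟙 M := rfl
  have hqF : q ≫ F.τ₁ = f ≫ q' :=
    ModuleCat.hom_ext (LinearMap.ext fun m => Subtype.ext (map_smul f.hom (x ^ n) m))
  -- The image of `ξ` in `x^n M` maps to `x^n ξ = 0` in `M`, so it comes from a class `ζ` in `M/x^n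
  -- M`.
  obtain ⟨ζ, hζ⟩ := Ext.covariant_sequence_exact₁ _ hS (ξ.comp (Ext.mk₀ q) (add_zero _)) (by
    rw [Ext.comp_assoc_of_third_deg_zero, Ext.mk₀_comp_mk₀, hq]
    exact comp_mk₀_smul_id_eq_zero ξ hxn) rfl
  -- By naturality the connecting image of `fq n (ζ)` is the image of `f(ξ) = 0`, so `fq n (ζ)`
  -- lifts to a class `ω` in `N`.
  obtain ⟨ω, hω⟩ := Ext.covariant_sequence_exact₃ _ hT (ζ.comp (Ext.mk₀ (fq n)) (add_zero _)) rfl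
    (by
      have h1 := ShortComplex.ShortExact.extClass_naturality hS hT F
      rw [Ext.comp_assoc _ _ _ (add_zero _) (zero_add 1) (by omega), ← h1,
        ← Ext.comp_assoc _ _ _ rfl (add_zero 1) (by omega), hζ,
        Ext.comp_assoc_of_third_deg_zero, Ext.mk₀_comp_mk₀, hqF, ← Ext.mk₀_comp_mk₀,
        ← Ext.comp_assoc_of_third_deg_zero, hξ, Ext.zero_comp])
  -- Multiplication by `x^n` into the quotient by `x^(2n)` replaces `ω` by `x^n ω = 0`. This removes
  -- the ambiguity of the lift without any condition on torsion in `N`.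
  have hζμ : (ζ.comp (Ext.mk₀ μ) (add_zero _)).comp (Ext.mk₀ (fq (n + n))) (add_zero _) = 0 := by
    rw [Ext.comp_assoc_of_third_deg_zero, Ext.mk₀_comp_mk₀, hμν, ← Ext.mk₀_comp_mk₀,
      ← Ext.comp_assoc_of_third_deg_zero, ← hω, Ext.comp_assoc_of_third_deg_zero,
      Ext.mk₀_comp_mk₀, hν, ← Ext.mk₀_comp_mk₀, ← Ext.comp_assoc_of_third_deg_zero,
      comp_mk₀_smul_id_eq_zero ω hxn, Ext.zero_comp]
  obtain ⟨l, hl, hζl⟩ := h (n + n) (Nat.add_pos_left hn n) k _ hζμ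
  let w : M ⟶ (kernelShortComplex (π (n + n))).X₁ := q ≫ X.τ₁
  have hw : ∀ m : M, (w.hom m).1 = x ^ (n + n) • m := fun m => by
    rw [pow_add, mul_smul]
    rfl
  have hwsurj : Function.Surjective w.hom := fun y => by
    obtain ⟨m, hm⟩ := (hπk _ y.1).1 y.2
    exact ⟨m, Subtype.ext ((hw m).trans hm)⟩
  have hW := kernelShortComplex_shortExact hwsurj
  have hξw : ξ.comp (Ext.mk₀ w) (add_zero _) =
      (ζ.comp (Ext.mk₀ μ) (add_zero _)).comp hS'.extClass rfl := by
    have h1 := ShortComplex.ShortExact.extClass_naturality hS hS' X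
    rw [← Ext.mk₀_comp_mk₀, ← Ext.comp_assoc_of_third_deg_zero, ← hζ,
      Ext.comp_assoc _ _ _ rfl (add_zero 1) (by omega), h1,
      ← Ext.comp_assoc _ _ _ (add_zero _) (zero_add 1) (by omega)]
  refine VanishesInLimit.of_restrict hl ?_
  -- The restricted `ξ` dies in `x^(2n) M`, so it comes from the kernel of `x^(2n)` on `M`, a
  -- torsion module whose classes of positive degree vanish in the limit.
  obtain ⟨θ, hθ⟩ := Ext.covariant_sequence_exact₂ _ hW
    ((Ext.mk₀ (quotientPowMap I hl)).comp ξ (zero_add _)) (by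
      rw [Ext.comp_assoc_of_third_deg_zero, hξw,
        ← Ext.comp_assoc _ _ _ (zero_add _) rfl (by omega), hζl, Ext.zero_comp])
  rw [← hθ]
  refine (vanishesInLimit_of_powerTorsion_eq_top _ ?_ θ).comp _ _
  refine eq_top_iff.2 fun y _ => ?_
  obtain ⟨s, hs⟩ := htors (n + n) (Nat.add_pos_left hn n) y.1
    ((hw y.1).symm.trans (congrArg Subtype.val y.2))
  exact ⟨s, fun r hr => Subtype.ext (hs r hr)⟩

end Limit

/-! ### Frobenius on quotients, and injectivity in the limit. -/

section FrobeniusQuotient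

variable {R : Type u} [CommRing R] (p : ℕ) [ExpChar R p]

/-- `F_* (R ⧸ J)`. -/
abbrev frobeniusQuotient (J : Ideal R) : ModuleCat.{u} R :=
  (ModuleCat.restrictScalars (frobenius R p)).obj (ModuleCat.of R (R ⧸ J))

/-- The map `a ↦ a ^ p` from `R` to `F_* (R ⧸ J)`. -/
def frobeniusMk (J : Ideal R) : ModuleCat.of R R ⟶ frobeniusQuotient p J :=
  frobeniusHom R p ≫ (ModuleCat.restrictScalars (frobenius R p)).map (ModuleCat.ofHom J.mkQ)

/-- The map `a ↦ a ^ p` from `R ⧸ I` to `F_* (R ⧸ J)`. -/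
def frobeniusQuotientMap {I J : Ideal R} (h : ∀ a ∈ I, a ^ p ∈ J) :
    ModuleCat.of R (R ⧸ I) ⟶ frobeniusQuotient p J :=
  ModuleCat.ofHom (Y := frobeniusQuotient p J)
    (I.liftQ (frobeniusMk p J).hom fun a ha => (Submodule.Quotient.mk_eq_zero J).2 (h a ha))

variable {p}

lemma pow_mem_sup_span_pow {I J : Ideal R} (h : ∀ a ∈ I, a ^ p ∈ J) (y a : R)
    (ha : a ∈ I ⊔ Ideal.span {y}) : a ^ p ∈ J ⊔ Ideal.span {y ^ p} := by
  obtain ⟨b, hb⟩ := mem_sup_span_singleton.1 ha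
  refine mem_sup_span_singleton.2 ⟨b ^ p, ?_⟩
  rw [← mul_pow, ← sub_pow_expChar]
  exact h _ hb

lemma factor_eq_zero_iff {I : Ideal R} {y : R} (m : R ⧸ I) :
    Submodule.factor (le_sup_left : I ≤ I ⊔ Ideal.span {y}) m = 0 ↔ ∃ m' : R ⧸ I, y • m' = m := by
  obtain ⟨a, rfl⟩ := Submodule.Quotient.mk_surjective _ m
  rw [← Submodule.mkQ_apply, Submodule.factor_mk, Submodule.mkQ_apply,
    Submodule.Quotient.mk_eq_zero, mem_sup_span_singleton]
  constructor
  · rintro ⟨b, hb⟩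
    exact ⟨Submodule.Quotient.mk b, ((Submodule.Quotient.eq I).2 hb).symm⟩
  · rintro ⟨m', hm'⟩
    obtain ⟨b, rfl⟩ := Submodule.Quotient.mk_surjective _ m'
    exact ⟨b, (Submodule.Quotient.eq I).1 hm'.symm⟩

lemma injectiveInLimit_frobeniusQuotientMap [IsNoetherianRing R] {m I J : Ideal R} {xs : List R}
    (hmem : ∀ x ∈ xs, x ∈ m) (hreg : ∀ r ∈ m, IsPowRegularAway r I xs)
    (hinj : IsFrobeniusInjective p I J xs) (h : ∀ a ∈ I, a ^ p ∈ J) :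
    InjectiveInLimit m (frobeniusQuotientMap p h) xs.length := by
  induction xs generalizing I J with
  | nil =>
    have hmono : Mono (frobeniusQuotientMap p h) := by
      refine (ModuleCat.mono_iff_injective _).2 ?_
      refine (injective_iff_map_eq_zero (frobeniusQuotientMap p h).hom).2 fun y hy => ?_
      obtain ⟨a, rfl⟩ := Submodule.Quotient.mk_surjective _ y
      exact (Submodule.Quotient.mk_eq_zero _).2 
        (hinj a ((Submodule.Quotient.mk_eq_zero J).1 hy))
    intro k ξ hξ
    have : ξ = 0 := Abelian.Ext.postcomp_mk₀_injective_of_mono _ (frobeniusQuotientMap p h)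
      (hξ.trans (map_zero _).symm)
    subst this
    exact ⟨k, le_rfl, Abelian.Ext.comp_zero ..⟩
  | cons x xs ih =>
    refine InjectiveInLimit.succ (hmem x List.mem_cons_self)
      (Mq := fun n => ModuleCat.of R (R ⧸ I ⊔ Ideal.span {x ^ n}))
      -- On `F_* (R ⧸ J)` the element `x^n` acts as `(x^n)^p`.
      (Nq := fun n => frobeniusQuotient p (J ⊔ Ideal.span {(x ^ n) ^ p}))
      (fun n => ModuleCat.ofHom (Submodule.factor le_sup_left))
      (fun n => (ModuleCat.restrictScalars (frobenius R p)).map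
        (ModuleCat.ofHom (Submodule.factor le_sup_left)))
      (fun n => frobeniusQuotientMap p (pow_mem_sup_span_pow h (x ^ n)))
      (fun n => Submodule.factor_surjective le_sup_left)
      (fun n => Submodule.factor_surjective (le_sup_left : J ≤ J ⊔ Ideal.span {(x ^ n) ^ p}))
      (fun n y => factor_eq_zero_iff y) (fun n y => factor_eq_zero_iff (y := (x ^ n) ^ p) y)
      (fun n => ?_) (fun n hn y hy => ?_) (fun n hn => ?_)
    · refine ModuleCat.hom_ext (LinearMap.ext fun y => ?_)
      obtain ⟨a, rfl⟩ := Submodule.Quotient.mk_surjective _ y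
      rfl
    · obtain ⟨a, rfl⟩ := Submodule.Quotient.mk_surjective _ y
      have hxa : x ^ n * a ∈ I := (Submodule.Quotient.mk_eq_zero _).1 hy
      -- Each `r ∈ m` has its own exponent; finite generation of `m` makes it uniform.
      have hle : m ≤ (I.colon {a}).radical := fun r hr => by
        obtain ⟨k, hk⟩ := (hreg r hr n hn).1 a hxa
        exact ⟨k, Submodule.mem_colon_singleton.2 hk⟩
      obtain ⟨k, hk⟩ := Ideal.exists_pow_le_of_le_radical_of_fg hle (IsNoetherian.noetherian m)
      exact ⟨k, fun r hr => (Submodule.Quotient.mk_eq_zero _).2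
        (Submodule.mem_colon_singleton.1 (hk hr))⟩
    · exact ih (fun y hy => hmem y (List.mem_cons_of_mem x hy)) (fun r hr => (hreg r hr n hn).2)
        (hinj n hn) _

/-- The first `j` parameters serve for the dimension shifts, the others for Krull's intersection
theorem. -/
lemma injectiveInLimit_frobeniusHom [IsLocalRing R] [IsNoetherianRing R]
    (hR : ∀ (n : ℕ) (x : Fin n → R), IsSystemOfParameters x →
      IsFrobeniusClosed p (Ideal.span (Set.range x)))
    {j : ℕ} (hj : (j : WithBot ℕ∞) ≤ ringKrullDim R) :
    InjectiveInLimit (maximalIdeal R) (frobeniusHom R p) j := by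
  obtain ⟨d, hd⟩ : ∃ d : ℕ, (d : WithBot ℕ∞) = ringKrullDim R := by
    have h := ringKrullDim_ne_top (R := R)
    have h' := ringKrullDim_ne_bot (R := R)
    obtain ⟨e, he⟩ := WithBot.ne_bot_iff_exists.1 h'
    rw [← he] at h ⊢
    have : e ≠ ⊤ := fun h'' => h (by rw [h'']; rfl)
    obtain ⟨d, rfl⟩ := ENat.ne_top_iff_exists.1 this
    exact ⟨d, rfl⟩
  obtain ⟨xs, hlen, hmem, hreg, hrad⟩ := exists_isRegularAway_radical_eq hd
  have hjd : j ≤ d := by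
    rw [← hd] at hj
    exact_mod_cast hj
  have hxs : xs.take j ++ xs.drop j = xs := List.take_append_drop j xs
  have hinj := isFrobeniusInjective_of_isFrobeniusClosed (p := p) hR [] (xs.take j) (xs.drop j)
    (fun y hy => hmem y (List.mem_of_mem_drop hy)) (by rw [hxs, List.nil_append, hlen, hd])
    (by rw [hxs, Ideal.ofList_nil, bot_sup_eq, hrad])
  rw [List.map_nil, Ideal.ofList_nil] at hinj
  have h0 : ∀ a ∈ (⊥ : Ideal R), a ^ p ∈ (⊥ : Ideal R) := fun a ha => by
    rw [Ideal.mem_bot.1 ha, zero_pow (expChar_ne_zero R p)]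
    exact zero_mem _
  have := injectiveInLimit_frobeniusQuotientMap (m := maximalIdeal R)
    (fun y hy => hmem y (List.mem_of_mem_take hy))
    (fun r hr => (IsRegularAway.of_append_left (ys := xs.drop j)
      (by rw [hxs]; exact hreg r hr)).isPowRegularAway) hinj h0
  rw [List.length_take, hlen, min_eq_left hjd] at this
  exact this.of_comm (Submodule.quotEquivOfEqBot ⊥ rfl).symm.toModuleIso
    ((ModuleCat.restrictScalars (frobenius R p)).map (ModuleCat.ofHom (Submodule.mkQ ⊥)))
    (ModuleCat.hom_ext (LinearMap.ext fun _ => rfl))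

end FrobeniusQuotient

/-! ### Homology in the opposite category, on elements. -/

section OppositeHomology

variable {R : Type u} [CommRing R] (K : ChainComplex (ModuleCat.{u} R)ᵒᵖ ℕ) (n : ℕ)

lemma homologyι_unop_surjective : Function.Surjective (K.homologyι n).unop.hom :=
  (ModuleCat.epi_iff_surjective _).1 inferInstance

lemma pOpcycles_unop_injective : Function.Injective (K.pOpcycles n).unop.hom :=
  (ModuleCat.mono_iff_injective _).1 inferInstance

/-- The free index `m` also covers degree zero, where only the zero differential is available. -/
lemma homologyι_unop_eq_zero_iff (z : (K.opcycles n).unop) :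
    (K.homologyι n).unop.hom z = 0 ↔
      ∃ (m : ℕ) (g : (K.X m).unop), (K.d n m).unop.hom g = (K.pOpcycles n).unop.hom z := by
  constructor
  · intro hz
    have hex := (ShortComplex.exact_of_f_is_kernel (ShortComplex.mk _ _
      (K.homologyι_comp_fromOpcycles n ((ComplexShape.down ℕ).next n)))
      (K.homologyIsKernel n _ rfl)).unop
    obtain ⟨g, hg⟩ := (ShortComplex.moduleCat_exact_iff _).1 hex z hz
    refine ⟨_, g, ?_⟩
    rw [← hg, ← K.p_fromOpcycles]
    rfl
  · rintro ⟨m, g, hg⟩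
    have hz : z = (K.fromOpcycles n m).unop.hom g := by
      apply pOpcycles_unop_injective K n
      rw [← hg, ← K.p_fromOpcycles]
      rfl
    rw [hz]
    have := K.homologyι_comp_fromOpcycles n m
    exact congr(($this).unop.hom g)

end OppositeHomology

/-! ### Comparison of the two `Ext` theories through cocycles. -/

section ExtClass

open Opposite

variable {R : Type u} [CommRing R] {A Y : ModuleCat.{u} R} (P : ProjectiveResolution A)

/-- The complex `Hom(P, Y)`, as a chain complex in the opposite category. -/
abbrev homComplexOp (Y : ModuleCat.{u} R) : ChainComplex (ModuleCat.{u} R)ᵒᵖ ℕ :=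
  (((linearYoneda R (ModuleCat.{u} R)).obj Y).rightOp.mapHomologicalComplex _).obj P.complex

/-- `η` is the class in `Extⁿ(A, Y)` of the cocycle `φ : Pₙ ⟶ Y`. -/
def IsExtClass {n : ℕ} (φ : P.complex.X n ⟶ Y)
    (η : ((Ext R (ModuleCat.{u} R) n).obj (op A)).obj Y) : Prop :=
  ∃ z : ((homComplexOp P Y).opcycles n).unop,
    ((homComplexOp P Y).pOpcycles n).unop.hom z = φ ∧
      (P.isoLeftDerivedObj ((linearYoneda R (ModuleCat.{u} R)).obj Y).rightOp n).hom.unop.hom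
        (((homComplexOp P Y).homologyι n).unop.hom z) = η

lemma exists_isExtClass {n : ℕ} (η : ((Ext R (ModuleCat.{u} R) n).obj (op A)).obj Y) :
    ∃ φ : P.complex.X n ⟶ Y, IsExtClass P φ η ∧ P.complex.d (n + 1) n ≫ φ = 0 := by
  let e := P.isoLeftDerivedObj ((linearYoneda R (ModuleCat.{u} R)).obj Y).rightOp n
  obtain ⟨z, hz⟩ := homologyι_unop_surjective (homComplexOp P Y) n (e.inv.unop.hom η)
  refine ⟨((homComplexOp P Y).pOpcycles n).unop.hom z, ⟨z, rfl, ?_⟩, ?_⟩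
  · rw [hz]
    exact congr(($(e.hom_inv_id)).unop.hom η)
  · have := (homComplexOp P Y).d_pOpcycles (n + 1) n
    exact congr(($this).unop.hom z)

variable {P}

lemma IsExtClass.eq_zero_iff {n : ℕ} {φ : P.complex.X n ⟶ Y}
    {η : ((Ext R (ModuleCat.{u} R) n).obj (op A)).obj Y} (h : IsExtClass P φ η) :
    η = 0 ↔ ∃ (m : ℕ) (g : P.complex.X m ⟶ Y), P.complex.d n m ≫ g = φ := by
  obtain ⟨z, rfl, rfl⟩ := h
  refine Iff.trans ?_ (homologyι_unop_eq_zero_iff (homComplexOp P Y) n z)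
  exact map_eq_zero_iff _ ((ModuleCat.mono_iff_injective _).1 inferInstance)

lemma IsExtClass.map {n : ℕ} {φ : P.complex.X n ⟶ Y}
    {η : ((Ext R (ModuleCat.{u} R) n).obj (op A)).obj Y} (h : IsExtClass P φ η)
    {Y' : ModuleCat.{u} R} (f : Y ⟶ Y') :
    IsExtClass P (φ ≫ f) ((((Ext R (ModuleCat.{u} R) n).obj (op A)).map f).hom η) := by
  obtain ⟨z, rfl, rfl⟩ := h
  let α := ((linearYoneda R (ModuleCat.{u} R)).map f).rightOp
  let β := (NatTrans.mapHomologicalComplex α (ComplexShape.down ℕ)).app P.complex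
  refine ⟨(HomologicalComplex.opcyclesMap β n).unop.hom z, ?_, ?_⟩
  · have := HomologicalComplex.p_opcyclesMap β n
    exact congr(($this).unop.hom z)
  · let e : (((linearYoneda R (ModuleCat.{u} R)).obj Y).rightOp.leftDerived n).obj A ≅
        (homComplexOp P Y).homology n := P.isoLeftDerivedObj _ n
    let e' : (((linearYoneda R (ModuleCat.{u} R)).obj Y').rightOp.leftDerived n).obj A ≅
        (homComplexOp P Y').homology n := P.isoLeftDerivedObj _ n
    have h₁ : (homComplexOp P Y').homologyι n ≫ HomologicalComplex.opcyclesMap β n =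
        HomologicalComplex.homologyMap β n ≫ (homComplexOp P Y).homologyι n :=
      (HomologicalComplex.homologyι_naturality β n).symm
    have h₂ : (NatTrans.leftDerived α n).app A ≫ e.hom =
        e'.hom ≫ HomologicalComplex.homologyMap β n := by
      rw [← Iso.eq_comp_inv, Category.assoc]
      exact P.leftDerived_app_eq α n
    have key : e'.hom ≫ (homComplexOp P Y').homologyι n ≫ HomologicalComplex.opcyclesMap β n =
        (NatTrans.leftDerived α n).app A ≫ e.hom ≫ (homComplexOp P Y).homologyι n := by
      rw [h₁, reassoc_of% h₂]
    exact congr(($key).unop.hom z)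

lemma IsExtClass.precomp {n : ℕ} {φ : P.complex.X n ⟶ Y}
    {η : ((Ext R (ModuleCat.{u} R) n).obj (op A)).obj Y} (h : IsExtClass P φ η)
    {A' : ModuleCat.{u} R} {P' : ProjectiveResolution A'} {a : A' ⟶ A}
    (ψ : ProjectiveResolution.Hom P' P a) :
    IsExtClass P' (ψ.hom.f n ≫ φ)
      ((((Ext R (ModuleCat.{u} R) n).map a.op).app Y).hom η) := by
  obtain ⟨z, rfl, rfl⟩ := h
  let F := ((linearYoneda R (ModuleCat.{u} R)).obj Y).rightOp
  let β := (F.mapHomologicalComplex (ComplexShape.down ℕ)).map ψ.hom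
  refine ⟨(HomologicalComplex.opcyclesMap β n).unop.hom z, ?_, ?_⟩
  · have := HomologicalComplex.p_opcyclesMap β n
    exact congr(($this).unop.hom z)
  · let e : (F.leftDerived n).obj A ≅ (homComplexOp P Y).homology n := P.isoLeftDerivedObj F n
    let e' : (F.leftDerived n).obj A' ≅ (homComplexOp P' Y).homology n :=
      P'.isoLeftDerivedObj F n
    have h₁ : (homComplexOp P' Y).homologyι n ≫ HomologicalComplex.opcyclesMap β n =
        HomologicalComplex.homologyMap β n ≫ (homComplexOp P Y).homologyι n :=
      (HomologicalComplex.homologyι_naturality β n).symm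
    have h₂ : (F.leftDerived n).map a ≫ e.hom = e'.hom ≫ HomologicalComplex.homologyMap β n :=
      ProjectiveResolution.isoLeftDerivedObj_hom_naturality a P' P ψ.hom
        ψ.hom_f_zero_comp_π_f_zero F n
    have key : e'.hom ≫ (homComplexOp P' Y).homologyι n ≫ HomologicalComplex.opcyclesMap β n =
        (F.leftDerived n).map a ≫ e.hom ≫ (homComplexOp P Y).homologyι n := by
      rw [h₁, reassoc_of% h₂]
    exact congr(($key).unop.hom z)

/-- The class of a cocycle is zero if and only if the cocycle is a coboundary. -/
lemma extMk_eq_zero_iff_exists {n : ℕ} (φ : P.complex.X n ⟶ Y)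
    (hφ : P.complex.d (n + 1) n ≫ φ = 0) :
    P.extMk φ (n + 1) rfl hφ = 0 ↔
      ∃ (m : ℕ) (g : P.complex.X m ⟶ Y), P.complex.d n m ≫ g = φ := by
  cases n with
  | zero =>
    have hd : ∀ m, P.complex.d 0 m = 0 := fun m => P.complex.shape _ _ (by simp)
    constructor
    · intro h
      have h' := congrArg P.extEquivCohomologyClass h
      rw [P.extEquivCohomologyClass_extMk, P.extEquivCohomologyClass_zero,
        CochainComplex.HomComplex.CohomologyClass.mk_eq_zero_iff,
        CochainComplex.HomComplex.Cocycle.toSingleMk_mem_coboundaries_iff _ _ _ _ _ 1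
          (by simp)] at h'
      obtain ⟨g, hg⟩ := h'
      -- The source of `g` lies in degree `1` of a complex living in degrees `≤ 0`, so degree zero
      -- has no nonzero coboundaries.
      have hg0 : g = 0 := (P.cochainComplex.isZero_of_isStrictlyLE 0 1).eq_of_src _ _
      rw [hg0, Limits.comp_zero] at hg
      refine ⟨0, 0, ?_⟩
      rw [Limits.comp_zero, ← cancel_epi (P.cochainComplexXIso _ 0 rfl).hom, ← hg,
        Limits.comp_zero]
    · rintro ⟨m, g, hg⟩
      rw [hd, Limits.zero_comp] at hg
      subst hg
      exact P.extMk_zero ..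
  | succ n =>
    rw [P.extMk_eq_zero_iff _ _ _ _ n rfl]
    refine ⟨fun ⟨g, hg⟩ => ⟨n, g, hg⟩, fun ⟨m, g, hg⟩ => ?_⟩
    by_cases hm : m = n
    · subst hm
      exact ⟨g, hg⟩
    · rw [P.complex.shape _ _ (by simpa using fun h => hm h), Limits.zero_comp] at hg
      exact ⟨0, by rw [Limits.comp_zero, hg]⟩

end ExtClass

/-! ### Passage to local cohomology. -/

section Colimit

open Opposite Limits

variable {R : Type u} [CommRing R] {I : Ideal R}

/-- A lift of a morphism to projective resolutions. -/
lemma nonempty_projectiveResolution_hom {A A' : ModuleCat.{u} R} (P' : ProjectiveResolution A')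
    (P : ProjectiveResolution A) (a : A' ⟶ A) : Nonempty (ProjectiveResolution.Hom P' P a) :=
  ⟨⟨ProjectiveResolution.lift a P' P, by
    simpa using ProjectiveResolution.lift_commutes_zero a P' P⟩⟩

/-- Injectivity in the limit, for the functors `Ext` that define local cohomology. -/
lemma InjectiveInLimit.exists_map_eq_zero {M N : ModuleCat.{u} R} {f : M ⟶ N} {j : ℕ}
    (h : InjectiveInLimit I f j) {k : ℕ}
    (η : ((Ext R (ModuleCat.{u} R) j).obj (op (quotientPow I k))).obj M)
    (hη : (((Ext R (ModuleCat.{u} R) j).obj (op (quotientPow I k))).map f).hom η = 0) :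
    ∃ (l : ℕ) (hkl : k ≤ l),
      (((Ext R (ModuleCat.{u} R) j).map (quotientPowMap I hkl).op).app M).hom η = 0 := by
  let P := fun k => projectiveResolution (quotientPow I k)
  obtain ⟨φ, hφη, hφ⟩ := exists_isExtClass (P k) η
  -- In both theories a class vanishes exactly when its cocycle is a coboundary, so vanishing
  -- transfers along `φ`.
  have hξ : ((P k).extMk φ (j + 1) rfl hφ).comp (Abelian.Ext.mk₀ f) (add_zero j) = 0 := by
    rw [ProjectiveResolution.extMk_comp_mk₀, extMk_eq_zero_iff_exists]
    exact (hφη.map f).eq_zero_iff.1 hη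
  obtain ⟨l, hkl, hl⟩ := h k _ hξ
  obtain ⟨ψ⟩ := nonempty_projectiveResolution_hom (P l) (P k) (quotientPowMap I hkl)
  rw [ProjectiveResolution.mk₀_comp_extMk _ _ _ _ ψ, extMk_eq_zero_iff_exists] at hl
  exact ⟨l, hkl, (hφη.precomp ψ).eq_zero_iff.2 hl⟩

lemma InjectiveInLimit.localCohomology_map_injective {M N : ModuleCat.{u} R} {f : M ⟶ N} {j : ℕ}
    (h : InjectiveInLimit I f j) :
    Function.Injective ((localCohomology I j).map f) := by
  let D := localCohomology.diagram (localCohomology.idealPowersDiagram I) j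
  have : HasColimit D :=
    localCohomology.hasColimitDiagram.{u, 0} (localCohomology.idealPowersDiagram I) j
  have hfil : IsFiltered (ℕᵒᵖᵒᵖ) := IsFiltered.of_equivalence (opOpEquivalence ℕ).symm
  have : PreservesFilteredColimitsOfSize.{0, 0} (forget (ModuleCat.{u} R)) :=
    preservesFilteredColimitsOfSize_shrink.{0, u, 0, u} _
  have (Y : ModuleCat.{u} R) :
      PreservesColimit (D ⋙ (evaluation _ _).obj Y) (forget (ModuleCat.{u} R)) :=
    (PreservesFilteredColimitsOfSize.preserves_filtered_colimits _).preservesColimit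
  refine (injective_iff_map_eq_zero ((localCohomology I j).map f).hom).2 fun x hx => ?_
  have hcolim (Y : ModuleCat.{u} R) :
      IsColimit (((evaluation _ _).obj Y).mapCocone (colimit.cocone D)) :=
    isColimitOfPreserves _ (colimit.isColimit D)
  obtain ⟨k, η, rfl⟩ := Concrete.isColimit_exists_rep _ (hcolim M) x
  have hnat : ((localCohomology I j).map f).hom (((colimit.ι D k).app M).hom η) =
      ((colimit.ι D k).app N).hom (((D.obj k).map f).hom η) :=
    congr(($((colimit.ι D k).naturality f)).hom η).symm
  have hx' : ((colimit.ι D k).app N).hom (((D.obj k).map f).hom η) =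
      ((colimit.ι D k).app N).hom 0 := by
    rw [map_zero]
    exact hnat.symm.trans hx
  obtain ⟨l, i, i', hi⟩ := (Concrete.isColimit_rep_eq_iff_exists _ (hcolim N) _ _).1 hx'
  have hzero : ((D.obj l).map f).hom (((D.map i).app M).hom η) = 0 := by
    refine Eq.trans ?_ (hi.trans (map_zero ((D.map i').app N).hom))
    exact congr(($((D.map i).naturality f)).hom η).symm
  -- At stage `l` the image under `f` is already zero, so a further restriction kills the
  -- representative itself.
  obtain ⟨m, hlm, hm⟩ := h.exists_map_eq_zero (k := l.unop.unop) _ hzero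
  let t : l ⟶ op (op m) := (homOfLE hlm).op.op
  have hw : D.map (i ≫ t) ≫ colimit.ι D (op (op m)) = colimit.ι D k := colimit.w D (i ≫ t)
  have happ : ((D.map (i ≫ t)).app M).hom η = 0 := by
    rw [D.map_comp]
    exact hm
  have : ((colimit.ι D (op (op m))).app M).hom (((D.map (i ≫ t)).app M).hom η) =
      ((colimit.ι D k).app M).hom η := congr((($hw).app M).hom η)
  rw [happ, map_zero] at this
  exact this.symm

end Colimit

/-! ### All degrees up to the dimension. -/

section Conclusion

variable {R : Type u} [CommRing R] [IsLocalRing R] [IsNoetherianRing R]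

lemma frobeniusActsInjectively_of_le_ringKrullDim {p : ℕ} [ExpChar R p]
    (hR : ∀ (n : ℕ) (x : Fin n → R), IsSystemOfParameters x →
      IsFrobeniusClosed p (Ideal.span (Set.range x)))
    {j : ℕ} (hj : (j : WithBot ℕ∞) ≤ ringKrullDim R) : FrobeniusActsInjectively R p j :=
  (injectiveInLimit_frobeniusHom hR hj).localCohomology_map_injective

/-- A regular sequence in `𝔪` lowers the dimension by its length, and the quotient, being
nontrivial, has nonnegative dimension. -/
lemma depth_le_ringKrullDim : (depth R : WithBot ℕ∞) ≤ ringKrullDim R := by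
  obtain ⟨e, he⟩ := WithBot.ne_bot_iff_exists.1 (ringKrullDim_ne_bot (R := R))
  rw [← he, WithBot.coe_le_coe]
  refine iSup_le fun ⟨rs, hreg, hmem⟩ => ?_
  have h := ringKrullDim_add_length_eq_ringKrullDim_of_isRegular rs hreg
  have hne : Ideal.ofList rs ≠ ⊤ := fun h => (maximalIdeal.isMaximal R).ne_top
    (top_le_iff.1 (h ▸ Ideal.span_le.2 hmem))
  have : Nontrivial (R ⧸ Ideal.ofList rs) := Ideal.Quotient.nontrivial_iff.2 hne
  have h0 : (0 : WithBot ℕ∞) ≤ ringKrullDim (R ⧸ Ideal.ofList rs) :=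
    ringKrullDim_nonneg_of_nontrivial
  have h1 := add_le_add_left h0 (rs.length : WithBot ℕ∞)
  rw [h, zero_add, ← he] at h1
  exact_mod_cast h1

end Conclusion

end FrobeniusAction

end

theorem mainTheorem8 {R : Type*} [CommRing R] [IsLocalRing R] [IsNoetherianRing R]
    (p : ℕ) [Fact p.Prime] [CharP R p]
    (hR : ∀ (n : ℕ) (x : Fin n → R), FrobeniusAction.IsSystemOfParameters x →
      FrobeniusAction.IsFrobeniusClosed p (Ideal.span (Set.range x))) :
    (∀ j : ℕ, (j : WithBot ℕ∞) = ringKrullDim R →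
      FrobeniusAction.FrobeniusActsInjectively R p j) ∧
    (∀ j : ℕ, (j : ℕ∞) = FrobeniusAction.depth R →
      FrobeniusAction.FrobeniusActsInjectively R p j) := by
  refine ⟨fun j hj => FrobeniusAction.frobeniusActsInjectively_of_le_ringKrullDim hR hj.le,
    fun j hj => FrobeniusAction.frobeniusActsInjectively_of_le_ringKrullDim hR ?_⟩
  have := FrobeniusAction.depth_le_ringKrullDim (R := R)
  rwa [← hj] at this
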